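/- Let $\mathcal X,\mathcal Y$ be finite nonempty alphabets and let $Q=Q_{Y\mid X,Y_1',Y_2'}$ be a conditional probability distribution on $\mathcal Y$ given $(x,y_1',y_2')\in\mathcal X\times\mathcal Y\times\mathcal Y$. The 2D NOST channel with constants $Q$ has node set $\mathbb Z_{\ge0}^2$ with the componentwise partial order $\preceq$. The nodes $(i,j)$ with $i=0$ or $j=0$ are initial nodes; they carry outputs only, with an arbitrary fixed joint law $P_0$. Every other node $v=(i,j)$ is a communication node with input $X_v$ and output $Y_v$; given the inputs $X^{\preceq v}$ and the outputs $Y^{\prec v}$, the output $Y_v$ has law $Q(\,\cdot\mid X_{i,j},Y_{i-1,j},Y_{i,j-1})$. Let $\mathcal C_n=\{1,\dots,n\}^2$. An $(n,M,\epsilon)$-code consists of encoders $f_v:[M]\times\mathcal Y^{\prec v}\to\mathcal X$ for $v\in\mathcal C_n$, used as $X_v=f_v(W,Y^{\prec v})$ where $\mathcal Y^{\prec v}$ includes the outputs of the initial nodes preceding $v$, and a decoder $g:\mathcal Y^{\mathcal C_n}\to[M]$, such that $\mathbb P[\,g(Y_{\mathcal C_n})\ne W\,]\le\epsilon$ for a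 message $W$ uniform on $[M]$ and independent of the initial outputs. Let $M^*(n,\epsilon)$ be the largest $M$ for which an $(n,M,\epsilon)$-code exists, and let $$C^{\mathrm{fb}}_{\mathrm{2D}}=\lim_{\epsilon\to0^+}\,\liminf_{n\to\infty}\frac1{|\mathcal C_n|}\log M^*(n,\epsilon).$$ Then this limit exists, the maximum below is attained, and $$C^{\mathrm{fb}}_{\mathrm{2D}}\ \le\ \max_{P_{X,Y_1',Y_2'}} I(X;Y\mid Y_1',Y_2')\quad\text{subject to}\quad P_Y=P_{Y_1'}=P_{Y_2'},$$ where the maximum is over all joint laws of $(X,Y_1',Y_2')$ on $\mathcal X\times\mathcal Y\times\mathcal Y$ satisfying the constraint, and $Y$ is drawn from $Q(\,\cdot\mid X,Y_1',Y_2')$; here $Y_1'$ and $Y_2'$ stand for the outputs of the left and the bottom neighbor, respectively. -/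

import Mathlib

open Filter Topology

/-! ### Information measures on finite alphabets -/

/-- Shannon entropy `H(p) = - ∑ a, p a * log (p a)` (natural logarithm, `0 log 0 = 0`). -/
noncomputable def entropy {α : Type*} [Fintype α] (p : α → ℝ) : ℝ :=
  ∑ a, Real.negMulLog (p a)

/-- Conditional mutual information
`I(A; B | C) = H(A, C) + H(B, C) - H(A, B, C) - H(C)` of `(A, B, C) ∼ p`. -/
noncomputable def condMutualInfo {α β γ : Type*} [Fintype α] [Fintype β] [Fintype γ]
    (p : α × β × γ → ℝ) : ℝ :=
  entropy (fun ac : α × γ => ∑ b, p (ac.1, b, ac.2))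
    + entropy (fun bc : β × γ => ∑ a, p (a, bc.1, bc.2))
    - entropy p
    - entropy (fun c : γ => ∑ a, ∑ b, p (a, b, c))

namespace TwoDimNOST

/-! ### The index poset

The set of nodes is `ℕ × ℕ`, i.e. `ℤ_{≥ 0}²`, and its Mathlib order is the componentwise one:
`(i, j) ≤ (k, l)` iff `i ≤ k` and `j ≤ l`, and `u < v` iff `u ≤ v` and `u ≠ v`. -/

/-- Initial nodes: the left and bottom boundaries of the quadrant. -/
def IsInitial (v : ℕ × ℕ) : Prop := v.1 = 0 ∨ v.2 = 0

/-- The finite square `V_n = {(i, j) | 0 ≤ i, j ≤ n}`. -/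
def grid (n : ℕ) : Finset (ℕ × ℕ) := Finset.Icc (0, 0) (n, n)

/-- The communication nodes `C_n = {(i, j) | 1 ≤ i, j ≤ n}` of the square `V_n`. -/
def commGrid (n : ℕ) : Finset (ℕ × ℕ) := Finset.Icc (1, 1) (n, n)

theorem mem_grid_of_le {n : ℕ} {u v : ℕ × ℕ} (hv : v ∈ commGrid n) (huv : u ≤ v) :
    u ∈ grid n :=
  Finset.mem_Icc.2 ⟨⟨Nat.zero_le _, Nat.zero_le _⟩, huv.trans (Finset.mem_Icc.1 hv).2⟩

/-- A communication node, seen as a node of the square. -/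
def toGrid {n : ℕ} (v : commGrid n) : grid n := ⟨v.1, mem_grid_of_le v.2 le_rfl⟩

/-- The left neighbor `(i - 1, j)` of a communication node `(i, j)`. -/
def left {n : ℕ} (v : commGrid n) : grid n :=
  ⟨(v.1.1 - 1, v.1.2), mem_grid_of_le v.2 ⟨Nat.sub_le _ _, le_rfl⟩⟩

/-- The bottom neighbor `(i, j - 1)` of a communication node `(i, j)`. -/
def bottom {n : ℕ} (v : commGrid n) : grid n :=
  ⟨(v.1.1, v.1.2 - 1), mem_grid_of_le v.2 ⟨le_rfl, Nat.sub_le _ _⟩⟩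

/-- The outputs `Y^{≺ v}` of all nodes strictly preceding `v`, read off the outputs on `V_n`. -/
def past {𝓨 : Type*} {n : ℕ} (v : commGrid n) (y : grid n → 𝓨) :
    {u : ℕ × ℕ // u < v.1} → 𝓨 :=
  fun u => y ⟨u.1, mem_grid_of_le v.2 u.2.le⟩

/-! ### Feedback codes -/

/-- A feedback code with messages `Fin M` over the communication nodes of the `n`-th square:
the encoder at `v` sees the message and the outputs at the nodes preceding `v`, and the decoder
sees the outputs at the communication nodes. -/
structure FeedbackCode (𝓧 𝓨 : Type*) (n M : ℕ) where
  enc : (v : commGrid n) → Fin M → ({u : ℕ × ℕ // u < v.1} → 𝓨) → 𝓧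
  dec : (commGrid n → 𝓨) → Fin M

section Channel

variable {𝓧 𝓨 : Type*} [Fintype 𝓨] [MeasurableSpace 𝓨]

/-- The probability that the outputs on `V_n` equal `y` when message `w` is sent. The outputs
at the initial nodes have joint law `P₀`; given the outputs preceding `v = (i, j)`, the output
at `v` has law `Q x y₁' y₂'`, with `x` the input at `v`, `y₁'` the output at `(i - 1, j)` and
`y₂'` the output at `(i, j - 1)`. -/
noncomputable def outputProb (P₀ : MeasureTheory.Measure ({v : ℕ × ℕ // IsInitial v} → 𝓨))
    (Q : 𝓧 → 𝓨 → 𝓨 → 𝓨 → ℝ) {n M : ℕ} (c : FeedbackCode 𝓧 𝓨 n M) (w : Fin M)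
    (y : grid n → 𝓨) : ℝ :=
  P₀.real {ω | ∀ (u : {v : ℕ × ℕ // IsInitial v}) (hu : u.1 ∈ grid n), ω u = y ⟨u.1, hu⟩} *
    ∏ v : commGrid n,
      Q (c.enc v w (past v y)) (y (left v)) (y (bottom v)) (y (toGrid v))

open Classical in
/-- The error probability `ℙ[W ≠ Ŵ]` for a message `W` uniform on `Fin M`. -/
noncomputable def errorProb (P₀ : MeasureTheory.Measure ({v : ℕ × ℕ // IsInitial v} → 𝓨))
    (Q : 𝓧 → 𝓨 → 𝓨 → 𝓨 → ℝ) {n M : ℕ} (c : FeedbackCode 𝓧 𝓨 n M) : ℝ :=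
  (∑ w : Fin M, ∑ y : grid n → 𝓨 with c.dec (fun v => y (toGrid v)) ≠ w,
    outputProb P₀ Q c w y) / M

/-- `M*(n, ε)`: the maximal message size of a code on the `n`-th square with error probability
at most `ε`. -/
noncomputable def maxMessages
    (P₀ : MeasureTheory.Measure ({v : ℕ × ℕ // IsInitial v} → 𝓨))
    (Q : 𝓧 → 𝓨 → 𝓨 → 𝓨 → ℝ) (n : ℕ) (ε : ℝ) : ℕ∞ :=
  ⨆ M ∈ {M : ℕ | ∃ c : FeedbackCode 𝓧 𝓨 n M, errorProb P₀ Q c ≤ ε}, (M : ℕ∞)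

/-- `liminf_{n → ∞} (1 / |C_n|) log M*(n, ε)`. -/
noncomputable def achievableRate
    (P₀ : MeasureTheory.Measure ({v : ℕ × ℕ // IsInitial v} → 𝓨))
    (Q : 𝓧 → 𝓨 → 𝓨 → 𝓨 → ℝ) (ε : ℝ) : EReal :=
  liminf (fun n : ℕ =>
    ENNReal.log (maxMessages P₀ Q n ε : ENNReal) / (((commGrid n).card : ℝ) : EReal)) atTop

/-- The feedback capacity `lim_{ε → 0⁺} liminf_{n → ∞} (1 / |C_n|) log M*(n, ε)`. -/
noncomputable def feedbackCapacity
    (P₀ : MeasureTheory.Measure ({v : ℕ × ℕ // IsInitial v} → 𝓨))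
    (Q : 𝓧 → 𝓨 → 𝓨 → 𝓨 → ℝ) : EReal :=
  limUnder (𝓝[>] (0 : ℝ)) (achievableRate P₀ Q)

end Channel

/-! ### The single-letter problem -/

section SingleLetter

variable {𝓧 𝓨 : Type*} [Fintype 𝓧] [Fintype 𝓨]

/-- The joint law of `(X, Y, (Y₁', Y₂'))` when `(X, Y₁', Y₂') ∼ P` and `Y` is the channel
output. -/
def jointLaw (Q : 𝓧 → 𝓨 → 𝓨 → 𝓨 → ℝ) (P : 𝓧 × 𝓨 × 𝓨 → ℝ) : 𝓧 × 𝓨 × (𝓨 × 𝓨) → ℝ :=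
  fun z => P (z.1, z.2.2.1, z.2.2.2) * Q z.1 z.2.2.1 z.2.2.2 z.2.1

/-- The laws `P` of `(X, Y₁', Y₂')` such that `P_Y = P_{Y₁'} = P_{Y₂'}`. -/
def feasible (Q : 𝓧 → 𝓨 → 𝓨 → 𝓨 → ℝ) : Set (𝓧 × 𝓨 × 𝓨 → ℝ) :=
  {P | P ∈ stdSimplex ℝ (𝓧 × 𝓨 × 𝓨) ∧
    (∀ b : 𝓨, ∑ x, ∑ y₁, ∑ y₂, P (x, y₁, y₂) * Q x y₁ y₂ b = ∑ x, ∑ y₂, P (x, b, y₂)) ∧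
    (∀ b : 𝓨, ∑ x, ∑ y₁, ∑ y₂, P (x, y₁, y₂) * Q x y₁ y₂ b = ∑ x, ∑ y₁, P (x, y₁, b))}

end SingleLetter

end TwoDimNOST

/-! Fix a code and let `inputLaw` be the law of (input, left output, bottom output) at a uniformly
chosen communication node, averaged over the message. Two facts about this single-letter law give
the bound.

It is almost feasible. Averaged over the square, the law of `Y_v` minus that of a neighbor's output
telescopes along rows or columns. Only boundary terms survive, of order `n` against `n²` nodes
(`mismatch_inputLaw_le`).

It controls the rate. Replacing `Q` by the conditional output law given the two neighbors
(`outputLaw`) gives a reference law of the outputs that no longer depends on the message. The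
log-likelihood ratio against it is a sum of one-node information densities. By causality its mean is
`|C_n|` times the conditional mutual information under `inputLaw`, however the encoders use
feedback. A Fano-type inequality then bounds `(1 - ε) log M` by this mean plus `log 2`
(`log_card_le_card_mul_condMutualInfo`).

Compactness of the simplex and continuity of mutual information turn almost feasible into feasible
(`exists_mismatch_bound`). The same compactness shows that the feasible set is nonempty and the
maximum attained. The limit in `ε` exists by monotonicity. -/

namespace TwoDimNOST

/-! ### Causal products of kernels over a finite poset -/

section Causal

variable {ι V 𝓨 : Type*} [Fintype V] [DecidableEq V] [Fintype 𝓨]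

/-- Exchanging the value at `u` with the spare symbol `b` is an involution of the pairs `(y, b)`;
after reindexing by it, `b` is free. -/
theorem sum_sum_update (u : V) (H : (V → 𝓨) → ℝ) :
    ∑ y, ∑ b, H (Function.update y u b) = Fintype.card 𝓨 * ∑ y, H y := by
  have hinv : Function.Involutive
      (fun p : (V → 𝓨) × 𝓨 => (Function.update p.1 u p.2, p.1 u)) := by
    intro p
    ext <;> simp
  calc ∑ y, ∑ b, H (Function.update y u b)
      = ∑ p : (V → 𝓨) × 𝓨, H (hinv.toPerm _ p).1 := by
        rw [Fintype.sum_prod_type]; rfl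
    _ = ∑ p : (V → 𝓨) × 𝓨, H p.1 := Equiv.sum_comp (hinv.toPerm _) (fun p => H p.1)
    _ = _ := by
        rw [Fintype.sum_prod_type]
        simp [Finset.mul_sum]

/-- Summing out one coordinate. -/
theorem sum_mul_eq_of_update (u : V) (G K : (V → 𝓨) → ℝ)
    (hG : ∀ y b, G (Function.update y u b) = G y) :
    (Fintype.card 𝓨 : ℝ) * ∑ y, G y * K y
      = ∑ y, G y * ∑ b, K (Function.update y u b) := by
  rw [← sum_sum_update u (fun y => G y * K y)]
  simp only [hG, Finset.mul_sum]

variable [PartialOrder ι] (e : ι → V) (K : ι → (V → 𝓨) → ℝ)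

/-- Summing out an entire set of nodes on which the remaining factor does not depend. -/
theorem card_pow_mul_sum_mul_prod
    (hK1 : ∀ i y, ∑ b, K i (Function.update y (e i) b) = 1)
    (hK2 : ∀ i j, ¬ i ≤ j → ∀ y b, K j (Function.update y (e i) b) = K j y)
    (T : Finset ι) (F : (V → 𝓨) → ℝ)
    (hF : ∀ t ∈ T, ∀ y b, F (Function.update y (e t) b) = F y) :
    (Fintype.card 𝓨 : ℝ) ^ T.card * ∑ y, F y * ∏ i ∈ T, K i y = ∑ y, F y := by
  classical
  induction h : T.card generalizing T with
  | zero => simp [Finset.card_eq_zero.1 h]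
  | succ k ih =>
    -- A kernel at `j` can see the value at `t` only if `t ≤ j`, so at a maximal `t` no other
    -- remaining kernel does, and the kernel at `t` sums to one.
    obtain ⟨t, ht⟩ := T.exists_maximal (Finset.card_pos.1 (by omega))
    have htT : t ∈ T := ht.1
    have hstep : (Fintype.card 𝓨 : ℝ) * ∑ y, F y * ∏ i ∈ T, K i y
        = ∑ y, F y * ∏ i ∈ T.erase t, K i y := by
      have := sum_mul_eq_of_update (e t) (fun y => F y * ∏ i ∈ T.erase t, K i y) (K t) (by
        intro y b
        rw [hF t htT, Finset.prod_congr rfl]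
        intro j hj
        refine hK2 t j (fun hle => ?_) y b
        exact (Finset.mem_erase.1 hj).1 (le_antisymm (ht.2 (Finset.mem_erase.1 hj).2 hle) hle))
      simp only [hK1, mul_one] at this
      rw [← this]
      congr 1
      refine Finset.sum_congr rfl fun y _ => ?_
      rw [← Finset.prod_erase_mul T _ htT, mul_assoc]
    rw [pow_succ, mul_assoc, hstep]
    exact ih (T.erase t) (fun s hs => hF s (Finset.mem_of_mem_erase hs))
      (by rw [Finset.card_erase_of_mem htT, h]; rfl)

/-- A function of the nodes up to `v` whose conditional mean given the strict past of `v`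
vanishes has mean zero. -/
theorem sum_mul_prod_eq_zero [Fintype ι] [Nonempty 𝓨]
    (hK1 : ∀ i y, ∑ b, K i (Function.update y (e i) b) = 1)
    (hK2 : ∀ i j, ¬ i ≤ j → ∀ y b, K j (Function.update y (e i) b) = K j y)
    (v : ι) (F h : (V → 𝓨) → ℝ)
    (hF : ∀ t, ∀ y b, F (Function.update y (e t) b) = F y)
    (hh : ∀ t, ¬ t ≤ v → ∀ y b, h (Function.update y (e t) b) = h y)
    (h0 : ∀ y, ∑ b, K v (Function.update y (e v) b) * h (Function.update y (e v) b) = 0) :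
    ∑ y, F y * (∏ i, K i y) * h y = 0 := by
  classical
  have hc : (Fintype.card 𝓨 : ℝ) ≠ 0 := by exact_mod_cast Fintype.card_ne_zero
  set T : Finset ι := Finset.univ.filter (fun t => ¬ t ≤ v) with hT
  set S : Finset ι := Finset.univ.filter (fun t => t ≤ v) with hS
  have hvS : v ∈ S := by simp [hS]
  have hprod : ∀ y, ∏ i, K i y = (∏ i ∈ S.erase v, K i y) * K v y * ∏ i ∈ T, K i y := by
    intro y
    rw [Finset.prod_erase_mul S _ hvS, hS, hT, Finset.prod_filter_mul_prod_filter_not]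
  -- The nodes not below `v` are summed out here; in `h2` the node `v` is summed out, where `h0`
  -- applies because the kernels strictly below `v` ignore the value at `v`.
  have h1 := card_pow_mul_sum_mul_prod e K hK1 hK2 T
    (fun y => F y * (∏ i ∈ S.erase v, K i y) * (K v y * h y)) (by
      intro t ht y b
      have htv : ¬ t ≤ v := by simpa [hT] using ht
      rw [hF, hh t htv, hK2 t v htv, Finset.prod_congr rfl]
      intro j hj
      refine hK2 t j (fun hle => htv (hle.trans ?_)) y b
      simpa [hS] using (Finset.mem_erase.1 hj).2)
  have h2 := sum_mul_eq_of_update (e v) (fun y => F y * (∏ i ∈ S.erase v, K i y))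
    (fun y => K v y * h y) (by
      intro y b
      rw [hF, Finset.prod_congr rfl]
      intro j hj
      have hj' := Finset.mem_erase.1 hj
      have hjv : j ≤ v := by simpa [hS] using hj'.2
      exact hK2 v j (fun hle => hj'.1 (le_antisymm hjv hle)) y b)
  simp only [h0, mul_zero, Finset.sum_const_zero, mul_eq_zero, hc, false_or] at h2
  rw [h2, mul_eq_zero] at h1
  have h3 := h1.resolve_left (pow_ne_zero _ hc)
  rw [← h3]
  refine Finset.sum_congr rfl fun y _ => ?_
  rw [hprod]
  ring

end Causal

/-! ### The output law generated by a feedback code -/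

section Code

open MeasureTheory

variable {𝓧 𝓨 : Type*} {n M : ℕ}

theorem toGrid_injective : Function.Injective (toGrid (n := n)) := by
  intro u v h
  exact Subtype.ext (congrArg (fun z : grid n => z.1) h)

theorem left_lt (v : commGrid n) : (left v).1 < v.1 := by
  have h := (Finset.mem_Icc.1 v.2).1
  have h1 : 1 ≤ v.1.1 := h.1
  exact Prod.mk_lt_mk.2 (Or.inl ⟨Nat.sub_lt h1 one_pos, le_rfl⟩)

theorem bottom_lt (v : commGrid n) : (bottom v).1 < v.1 := by
  have h := (Finset.mem_Icc.1 v.2).1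
  have h1 : 1 ≤ v.1.2 := h.2
  exact Prod.mk_lt_mk.2 (Or.inr ⟨le_rfl, Nat.sub_lt h1 one_pos⟩)

theorem update_toGrid_of_lt {t v : commGrid n} (h : ¬ t < v) (y : grid n → 𝓨) (b : 𝓨)
    {u : grid n} (hu : u.1 < v.1) : Function.update y (toGrid t) b u = y u := by
  refine Function.update_of_ne (fun hut => h ?_) _ _
  rw [hut] at hu
  exact hu

theorem past_update {t v : commGrid n} (h : ¬ t < v) (y : grid n → 𝓨) (b : 𝓨) :
    past v (Function.update y (toGrid t) b) = past v y := by
  funext u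
  exact update_toGrid_of_lt h y b u.2

/-- The channel input, the outputs of the left and bottom neighbors. -/
def channelInput (c : FeedbackCode 𝓧 𝓨 n M) (v : commGrid n) (w : Fin M) (y : grid n → 𝓨) :
    𝓧 × 𝓨 × 𝓨 :=
  (c.enc v w (past v y), y (left v), y (bottom v))

theorem channelInput_update (c : FeedbackCode 𝓧 𝓨 n M) {t v : commGrid n} (h : ¬ t < v)
    (w : Fin M) (y : grid n → 𝓨) (b : 𝓨) :
    channelInput c v w (Function.update y (toGrid t) b) = channelInput c v w y := by
  simp only [channelInput, past_update h, update_toGrid_of_lt h y b (left_lt v),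
    update_toGrid_of_lt h y b (bottom_lt v)]

/-- The transition probability at a node along an output configuration. -/
def nodeProb (Q : 𝓧 → 𝓨 → 𝓨 → 𝓨 → ℝ) (c : FeedbackCode 𝓧 𝓨 n M) (w : Fin M)
    (v : commGrid n) (y : grid n → 𝓨) : ℝ :=
  Q (c.enc v w (past v y)) (y (left v)) (y (bottom v)) (y (toGrid v))

theorem nodeProb_eq (Q : 𝓧 → 𝓨 → 𝓨 → 𝓨 → ℝ) (c : FeedbackCode 𝓧 𝓨 n M) (w : Fin M) (v : commGrid n) (y : grid n → 𝓨) :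
    nodeProb Q c w v y = (fun z : 𝓧 × 𝓨 × 𝓨 => Q z.1 z.2.1 z.2.2) (channelInput c v w y)
      (y (toGrid v)) := rfl

theorem nodeProb_update_of_not_le {Q : 𝓧 → 𝓨 → 𝓨 → 𝓨 → ℝ} (c : FeedbackCode 𝓧 𝓨 n M) (w : Fin M) (t v : commGrid n) (h : ¬ t ≤ v)
    (y : grid n → 𝓨) (b : 𝓨) :
    nodeProb Q c w v (Function.update y (toGrid t) b) = nodeProb Q c w v y := by
  rw [nodeProb_eq, nodeProb_eq, channelInput_update c (fun h' => h h'.le),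
    Function.update_of_ne]
  intro h'
  exact h (toGrid_injective h').ge

theorem nodeProb_update_self {Q : 𝓧 → 𝓨 → 𝓨 → 𝓨 → ℝ} (c : FeedbackCode 𝓧 𝓨 n M) (w : Fin M) (v : commGrid n) (y : grid n → 𝓨) (b : 𝓨) :
    nodeProb Q c w v (Function.update y (toGrid v) b)
      = (fun z : 𝓧 × 𝓨 × 𝓨 => Q z.1 z.2.1 z.2.2) (channelInput c v w y) b := by
  rw [nodeProb_eq, channelInput_update c (lt_irrefl v), Function.update_self]

theorem sum_nodeProb_update [Fintype 𝓨] {Q : 𝓧 → 𝓨 → 𝓨 → 𝓨 → ℝ}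
    (hQ : ∀ x y₁ y₂, Q x y₁ y₂ ∈ stdSimplex ℝ 𝓨) (c : FeedbackCode 𝓧 𝓨 n M) (w : Fin M) (v : commGrid n) (y : grid n → 𝓨) :
    ∑ b, nodeProb Q c w v (Function.update y (toGrid v) b) = 1 := by
  simp only [nodeProb_update_self]
  exact (hQ _ _ _).2

variable [MeasurableSpace 𝓨]

/-- The probability that the initial outputs agree with `y`. -/
noncomputable def initialProb (P₀ : Measure ({v : ℕ × ℕ // IsInitial v} → 𝓨))
    (y : grid n → 𝓨) : ℝ :=
  P₀.real {ω | ∀ (u : {v : ℕ × ℕ // IsInitial v}) (hu : u.1 ∈ grid n), ω u = y ⟨u.1, hu⟩}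

theorem not_isInitial (v : commGrid n) : ¬ IsInitial v.1 := by
  have h := (Finset.mem_Icc.1 v.2).1
  have h1 : 1 ≤ v.1.1 := h.1
  have h2 : 1 ≤ v.1.2 := h.2
  unfold IsInitial
  omega

theorem isInitial_or_mem_commGrid (u : grid n) : IsInitial u.1 ∨ u.1 ∈ commGrid n := by
  have h := (Finset.mem_Icc.1 u.2).2
  have h1 : u.1.1 ≤ n := h.1
  have h2 : u.1.2 ≤ n := h.2
  by_cases hi : IsInitial u.1
  · exact Or.inl hi
  · unfold IsInitial at hi
    refine Or.inr (Finset.mem_Icc.2 ⟨⟨?_, ?_⟩, h⟩) <;> simp <;> omega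

theorem initialProb_update (P₀ : Measure ({v : ℕ × ℕ // IsInitial v} → 𝓨)) (t : commGrid n)
    (y : grid n → 𝓨) (b : 𝓨) :
    initialProb P₀ (Function.update y (toGrid t) b) = initialProb P₀ y := by
  unfold initialProb
  congr 1
  ext ω
  refine forall_congr' fun u => forall_congr' fun hu => ?_
  rw [Function.update_of_ne]
  intro h
  apply not_isInitial t
  have := u.2
  rwa [show u.1 = t.1 from congrArg (fun z : grid n => z.1) h] at this

theorem outputProb_eq (P₀ : Measure ({v : ℕ × ℕ // IsInitial v} → 𝓨)) (Q : 𝓧 → 𝓨 → 𝓨 → 𝓨 → ℝ)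
    (c : FeedbackCode 𝓧 𝓨 n M) (w : Fin M) (y : grid n → 𝓨) :
    outputProb P₀ Q c w y = initialProb P₀ y * ∏ v, nodeProb Q c w v y := rfl

variable [Fintype 𝓨]

/-- The cylinder constrains only the initial outputs, so each initial outcome is counted once per
assignment of the communication outputs. This factor cancels the one in `card_pow_mul_sum_mul_prod`.
-/
theorem sum_initialProb [DiscreteMeasurableSpace 𝓨]
    (P₀ : Measure ({v : ℕ × ℕ // IsInitial v} → 𝓨)) [IsProbabilityMeasure P₀] :
    ∑ y : grid n → 𝓨, initialProb P₀ y
      = (Fintype.card 𝓨 : ℝ) ^ (Fintype.card (commGrid n)) := by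
  classical
  set S : (grid n → 𝓨) → Set ({v : ℕ × ℕ // IsInitial v} → 𝓨) := fun y =>
    {ω | ∀ (u : {v : ℕ × ℕ // IsInitial v}) (hu : u.1 ∈ grid n), ω u = y ⟨u.1, hu⟩} with hS
  have hmeas : ∀ y, MeasurableSet (S y) := by
    intro y
    have : S y = ⋂ (u : {v : ℕ × ℕ // IsInitial v}), ⋂ (hu : u.1 ∈ grid n),
        (fun ω => ω u) ⁻¹' {y ⟨u.1, hu⟩} := by
      ext ω; simp [hS]
    rw [this]
    exact MeasurableSet.iInter fun u => MeasurableSet.iInter fun hu =>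
      measurable_pi_apply u (measurableSet_singleton _)
  have hcount : ∀ ω, ∑ y : grid n → 𝓨, (S y).indicator (fun _ => (1 : ℝ)) ω
      = (Fintype.card 𝓨 : ℝ) ^ (Fintype.card (commGrid n)) := by
    intro ω
    -- The configurations compatible with `ω` form a box: one value at each initial node, all values
    -- elsewhere.
    have h1 : (Finset.univ.filter fun y : grid n → 𝓨 => ω ∈ S y)
        = Fintype.piFinset (fun u : grid n =>
          if hu : IsInitial u.1 then {ω ⟨u.1, hu⟩} else (Finset.univ : Finset 𝓨)) := by
      ext y
      simp only [Finset.mem_filter, Finset.mem_univ, true_and, Fintype.mem_piFinset, hS,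
        Set.mem_ofPred_eq]
      constructor
      · intro h u
        split_ifs with hu
        · simpa using (h ⟨u.1, hu⟩ u.2).symm
        · simp
      · intro h u hu
        have := h ⟨u.1, hu⟩
        rw [dif_pos u.2] at this
        exact (Finset.mem_singleton.1 this).symm
    simp only [Set.indicator_apply]
    rw [Finset.sum_boole, h1, Fintype.card_piFinset]
    have h2 : ∀ u : grid n, (if hu : IsInitial u.1 then {ω ⟨u.1, hu⟩}
        else (Finset.univ : Finset 𝓨)).card
        = if u ∈ Finset.univ.map ⟨toGrid (n := n), toGrid_injective⟩ then Fintype.card 𝓨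
          else 1 := by
      intro u
      by_cases hu : IsInitial u.1
      · rw [dif_pos hu, if_neg, Finset.card_singleton]
        simp only [Finset.mem_map, Finset.mem_univ, true_and, Function.Embedding.coeFn_mk]
        rintro ⟨v, rfl⟩
        exact not_isInitial v hu
      · rw [dif_neg hu, if_pos, Finset.card_univ]
        simp only [Finset.mem_map, Finset.mem_univ, true_and, Function.Embedding.coeFn_mk]
        exact ⟨⟨u.1, (isInitial_or_mem_commGrid u).resolve_left hu⟩, rfl⟩
    rw [Finset.prod_congr rfl fun u _ => h2 u, Finset.prod_ite_mem, Finset.univ_inter,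
      Finset.prod_const, Finset.card_map, Finset.card_univ]
    push_cast
    rfl
  calc ∑ y : grid n → 𝓨, initialProb P₀ y
      = ∑ y : grid n → 𝓨, ∫ ω, (S y).indicator (fun _ => (1 : ℝ)) ω ∂P₀ := by
        refine Finset.sum_congr rfl fun y _ => ?_
        rw [integral_indicator (hmeas y)]
        simp [initialProb, hS]
    _ = ∫ ω, ∑ y : grid n → 𝓨, (S y).indicator (fun _ => (1 : ℝ)) ω ∂P₀ := by
        rw [integral_finsetSum]
        intro y _
        exact (integrable_const (1 : ℝ)).indicator (hmeas y)
    _ = _ := by simp only [hcount, integral_const]; simp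

variable (P₀ : Measure ({v : ℕ × ℕ // IsInitial v} → 𝓨)) {Q : 𝓧 → 𝓨 → 𝓨 → 𝓨 → ℝ}
  (hQ : ∀ x y₁ y₂, Q x y₁ y₂ ∈ stdSimplex ℝ 𝓨) (c : FeedbackCode 𝓧 𝓨 n M)

include hQ in
theorem outputProb_nonneg (w : Fin M) (y : grid n → 𝓨) : 0 ≤ outputProb P₀ Q c w y :=
  mul_nonneg measureReal_nonneg (Finset.prod_nonneg fun _ _ => (hQ _ _ _).1 _)

include hQ in
theorem sum_outputProb [DiscreteMeasurableSpace 𝓨] [Nonempty 𝓨] [IsProbabilityMeasure P₀]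
    (w : Fin M) : ∑ y, outputProb P₀ Q c w y = 1 := by
  have h := card_pow_mul_sum_mul_prod toGrid (nodeProb Q c w) (sum_nodeProb_update hQ c w)
    (nodeProb_update_of_not_le c w) Finset.univ (initialProb P₀)
    (fun t _ => initialProb_update P₀ t)
  rw [sum_initialProb, Finset.card_univ] at h
  have hc : (Fintype.card 𝓨 : ℝ) ≠ 0 := by exact_mod_cast Fintype.card_ne_zero
  simpa [outputProb_eq, pow_ne_zero _ hc] using h

include hQ in
/-- Given the past, the output at `v` has the law prescribed by the channel. -/
theorem sum_outputProb_mul_eq [Nonempty 𝓨] (w : Fin M) (v : commGrid n)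
    (φ : 𝓧 × 𝓨 × 𝓨 → 𝓨 → ℝ) :
    ∑ y, outputProb P₀ Q c w y * φ (channelInput c v w y) (y (toGrid v))
      = ∑ y, outputProb P₀ Q c w y * (fun z : 𝓧 × 𝓨 × 𝓨 => ∑ b, Q z.1 z.2.1 z.2.2 b * φ z b)
          (channelInput c v w y) := by
  -- The vanishing result is applied to `φ` minus its conditional mean given the past of `v`.
  have h := sum_mul_prod_eq_zero toGrid (nodeProb Q c w) (sum_nodeProb_update hQ c w)
    (nodeProb_update_of_not_le c w) v (initialProb P₀)
    (fun y => φ (channelInput c v w y) (y (toGrid v))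
      - (fun z : 𝓧 × 𝓨 × 𝓨 => ∑ b, Q z.1 z.2.1 z.2.2 b * φ z b) (channelInput c v w y))
    (initialProb_update P₀) (by
      intro t ht y b
      simp only [channelInput_update c (fun h' => ht (le_of_lt h'))]
      rw [Function.update_of_ne]
      intro h'
      exact ht (toGrid_injective h').ge) (by
      intro y
      simp only [nodeProb_update_self, channelInput_update c (lt_irrefl v),
        Function.update_self, mul_sub, Finset.sum_sub_distrib, ← Finset.sum_mul]
      rw [(hQ _ _ _).2]
      simp)
  simp only [mul_sub, Finset.sum_sub_distrib] at h
  exact sub_eq_zero.1 h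

end Code

end TwoDimNOST

/-! ### Conditional mutual information of a channel with side information -/

section Info
variable {α β γ : Type*} [Fintype α] [Fintype β] [Fintype γ]

/-- The bounds on `g` and `m` keep every logarithm's argument positive when `p * q ≠ 0`; otherwise
all terms vanish. -/
theorem mul_log_sum_identity {p q g m : ℝ} (hp : 0 ≤ p) (hq : 0 ≤ q)
    (hg : p * q ≤ g) (hm : p ≤ m) :
    -(p * q * Real.log p) + -(p * q * Real.log g) - -(p * q * Real.log (p * q))
      - -(p * q * Real.log m) = p * q * (Real.log q - Real.log (g / m)) := by
  rcases hp.eq_or_lt with rfl | hp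
  · simp
  rcases hq.eq_or_lt with rfl | hq
  · simp
  have hpq := mul_pos hp hq
  rw [Real.log_mul hp.ne' hq.ne', Real.log_div (hpq.trans_le hg).ne' (hp.trans_le hm).ne']
  ring

/-- Conditional mutual information between the input and the output of a channel `W` with
side information. -/
theorem condMutualInfo_channel {P : α × γ → ℝ} {W : α → γ → β → ℝ} (hP : ∀ z, 0 ≤ P z)
    (hW : ∀ a c, W a c ∈ stdSimplex ℝ β) :
    condMutualInfo (fun z : α × β × γ => P (z.1, z.2.2) * W z.1 z.2.2 z.2.1)
      = ∑ a, ∑ c, ∑ b, P (a, c) * W a c b * (Real.log (W a c b)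
          - Real.log ((∑ a', P (a', c) * W a' c b) / ∑ a', P (a', c))) := by
  have h1 : entropy (fun ac : α × γ => ∑ b, P (ac.1, ac.2) * W ac.1 ac.2 b)
      = ∑ a, ∑ c, ∑ b, -(P (a, c) * W a c b * Real.log (P (a, c))) := by
    unfold entropy
    rw [Fintype.sum_prod_type]
    refine Finset.sum_congr rfl fun a _ => Finset.sum_congr rfl fun c _ => ?_
    simp only
    rw [← Finset.mul_sum, (hW a c).2, Finset.sum_neg_distrib, ← Finset.sum_mul,
      ← Finset.mul_sum, (hW a c).2, Real.negMulLog, mul_one, neg_mul]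
  have h2 : entropy (fun bc : β × γ => ∑ a, P (a, bc.2) * W a bc.2 bc.1)
      = ∑ a, ∑ c, ∑ b, -(P (a, c) * W a c b * Real.log (∑ a', P (a', c) * W a' c b)) := by
    unfold entropy
    rw [Fintype.sum_prod_type, Finset.sum_comm, Finset.sum_comm (s := (Finset.univ : Finset α))]
    refine Finset.sum_congr rfl fun c _ => ?_
    rw [Finset.sum_comm (s := (Finset.univ : Finset α))]
    refine Finset.sum_congr rfl fun b _ => ?_
    simp only [Finset.sum_neg_distrib, ← Finset.sum_mul, Real.negMulLog, neg_mul]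
  have h3 : entropy (fun z : α × β × γ => P (z.1, z.2.2) * W z.1 z.2.2 z.2.1)
      = ∑ a, ∑ c, ∑ b, -(P (a, c) * W a c b * Real.log (P (a, c) * W a c b)) := by
    unfold entropy
    simp only [Fintype.sum_prod_type]
    refine Finset.sum_congr rfl fun a _ => ?_
    rw [Finset.sum_comm]
    refine Finset.sum_congr rfl fun c _ => Finset.sum_congr rfl fun b _ => ?_
    simp only [Real.negMulLog, neg_mul]
  have h4 : entropy (fun c : γ => ∑ a, ∑ b, P (a, c) * W a c b)
      = ∑ a, ∑ c, ∑ b, -(P (a, c) * W a c b * Real.log (∑ a', P (a', c))) := by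
    unfold entropy
    rw [Finset.sum_comm (s := (Finset.univ : Finset α))]
    refine Finset.sum_congr rfl fun c _ => ?_
    simp only [← Finset.mul_sum, (hW _ c).2, mul_one, Finset.sum_neg_distrib, ← Finset.sum_mul]
    simp only [Real.negMulLog, neg_mul]
  unfold condMutualInfo
  simp only at h1 h2 h3 h4 ⊢
  rw [h1, h2, h3, h4]
  simp only [← Finset.sum_add_distrib, ← Finset.sum_sub_distrib]
  refine Finset.sum_congr rfl fun a _ => Finset.sum_congr rfl fun c _ =>
    Finset.sum_congr rfl fun b _ => ?_
  refine mul_log_sum_identity (hP _) ((hW a c).1 b) ?_ ?_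
  · exact Finset.single_le_sum (f := fun a' => P (a', c) * W a' c b)
      (fun a' _ => mul_nonneg (hP _) ((hW a' c).1 b)) (Finset.mem_univ a)
  · exact Finset.single_le_sum (f := fun a' => P (a', c)) (fun a' _ => hP _) (Finset.mem_univ a)

theorem continuous_entropy : Continuous (entropy : (α → ℝ) → ℝ) := by
  unfold entropy
  exact continuous_finsetSum _ fun a _ => Real.continuous_negMulLog.comp (continuous_apply a)

theorem continuous_condMutualInfo : Continuous (condMutualInfo : (α × β × γ → ℝ) → ℝ) := by
  unfold condMutualInfo
  refine ((Continuous.add ?_ ?_).sub continuous_entropy).sub ?_ <;>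
  · refine continuous_entropy.comp ?_
    fun_prop

end Info

namespace TwoDimNOST

/-! ### Compactness for the single-letter problem -/

section SingleLetterAnalysis

variable {𝓧 𝓨 : Type*} [Fintype 𝓧] [Fintype 𝓨]

/-- The total mismatch between the output law and the laws of the two neighbors. -/
def mismatch (Q : 𝓧 → 𝓨 → 𝓨 → 𝓨 → ℝ) (P : 𝓧 × 𝓨 × 𝓨 → ℝ) : ℝ :=
  ∑ b, (|∑ x, ∑ y₁, ∑ y₂, P (x, y₁, y₂) * Q x y₁ y₂ b - ∑ x, ∑ y₂, P (x, b, y₂)|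
    + |∑ x, ∑ y₁, ∑ y₂, P (x, y₁, y₂) * Q x y₁ y₂ b - ∑ x, ∑ y₁, P (x, y₁, b)|)

theorem mismatch_nonneg (Q : 𝓧 → 𝓨 → 𝓨 → 𝓨 → ℝ) (P : 𝓧 × 𝓨 × 𝓨 → ℝ) : 0 ≤ mismatch Q P :=
  Finset.sum_nonneg fun _ _ => by positivity

theorem mem_feasible_iff (Q : 𝓧 → 𝓨 → 𝓨 → 𝓨 → ℝ) (P : 𝓧 × 𝓨 × 𝓨 → ℝ) :
    P ∈ feasible Q ↔ P ∈ stdSimplex ℝ (𝓧 × 𝓨 × 𝓨) ∧ mismatch Q P = 0 := by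
  unfold mismatch feasible
  rw [Finset.sum_eq_zero_iff_of_nonneg (fun _ _ => by positivity), Set.mem_ofPred_eq,
    ← forall_and]
  refine and_congr_right fun _ => forall_congr' fun b => ?_
  simp only [Finset.mem_univ, true_imp_iff]
  rw [add_eq_zero_iff_of_nonneg (abs_nonneg _) (abs_nonneg _), abs_eq_zero, abs_eq_zero,
    sub_eq_zero, sub_eq_zero]

theorem continuous_mismatch (Q : 𝓧 → 𝓨 → 𝓨 → 𝓨 → ℝ) : Continuous (mismatch Q) := by
  unfold mismatch
  fun_prop

theorem continuous_condMutualInfo_jointLaw (Q : 𝓧 → 𝓨 → 𝓨 → 𝓨 → ℝ) :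
    Continuous fun P => condMutualInfo (jointLaw Q P) := by
  refine continuous_condMutualInfo.comp ?_
  unfold jointLaw
  fun_prop

/-- The mismatch attains its minimum on the compact simplex, and approximate feasibility forces that
minimum to be zero, so a feasible law exists. -/
theorem exists_isGreatest (Q : 𝓧 → 𝓨 → 𝓨 → 𝓨 → ℝ)
    (h : ∀ η > 0, ∃ P ∈ stdSimplex ℝ (𝓧 × 𝓨 × 𝓨), mismatch Q P ≤ η) :
    ∃ C, IsGreatest ((fun P => condMutualInfo (jointLaw Q P)) '' feasible Q) C := by
  have hne : (feasible Q).Nonempty := by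
    obtain ⟨P₁, hP₁, -⟩ := h 1 one_pos
    obtain ⟨P, hP, hmin⟩ := (isCompact_stdSimplex ℝ (𝓧 × 𝓨 × 𝓨)).exists_isMinOn ⟨P₁, hP₁⟩
      (continuous_mismatch Q).continuousOn
    refine ⟨P, (mem_feasible_iff Q P).2 ⟨hP, le_antisymm ?_ (mismatch_nonneg Q P)⟩⟩
    refine le_of_forall_gt_imp_ge_of_dense fun η hη => ?_
    obtain ⟨P', hP', hle⟩ := h η hη
    exact (hmin hP').trans hle
  have hcomp : IsCompact (feasible Q) := by
    have : feasible Q = stdSimplex ℝ (𝓧 × 𝓨 × 𝓨) ∩ mismatch Q ⁻¹' {0} := by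
      ext P; exact mem_feasible_iff Q P
    rw [this]
    exact (isCompact_stdSimplex ℝ _).inter_right
      (isClosed_singleton.preimage (continuous_mismatch Q))
  exact (hcomp.image (continuous_condMutualInfo_jointLaw Q)).exists_isGreatest (hne.image _)

/-- The single-letter bound is stable under a small violation of the constraints. -/
theorem exists_mismatch_bound (Q : 𝓧 → 𝓨 → 𝓨 → 𝓨 → ℝ) {C : ℝ}
    (hC : C ∈ upperBounds ((fun P => condMutualInfo (jointLaw Q P)) '' feasible Q))
    {δ : ℝ} (hδ : 0 < δ) :
    ∃ η > 0, ∀ P ∈ stdSimplex ℝ (𝓧 × 𝓨 × 𝓨), mismatch Q P < η →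
      condMutualInfo (jointLaw Q P) ≤ C + δ := by
  set B := stdSimplex ℝ (𝓧 × 𝓨 × 𝓨) ∩ (fun P => condMutualInfo (jointLaw Q P)) ⁻¹' Set.Ici (C + δ)
  have hB : IsCompact B := (isCompact_stdSimplex ℝ _).inter_right
    (isClosed_Ici.preimage (continuous_condMutualInfo_jointLaw Q))
  rcases B.eq_empty_or_nonempty with hE | hne
  · refine ⟨1, one_pos, fun P hP _ => ?_⟩
    by_contra hlt
    have : P ∈ B := ⟨hP, (not_le.1 hlt).le⟩
    simp [hE] at this
  -- `η` is the least mismatch among laws with information at least `C + δ`; were it zero, the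
  -- minimizer would be feasible and exceed `C`.
  · obtain ⟨P₀, hP₀, hmin⟩ := hB.exists_isMinOn hne (continuous_mismatch Q).continuousOn
    refine ⟨mismatch Q P₀, lt_of_le_of_ne (mismatch_nonneg Q P₀) fun h0 => ?_, ?_⟩
    · have h1 := hC (Set.mem_image_of_mem _ ((mem_feasible_iff Q P₀).2 ⟨hP₀.1, h0.symm⟩))
      have h2 : C + δ ≤ condMutualInfo (jointLaw Q P₀) := hP₀.2
      linarith
    · intro P hP hlt
      by_contra hgt
      exact absurd (hmin (show P ∈ B from ⟨hP, (not_le.1 hgt).le⟩)) (not_le.2 hlt)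

end SingleLetterAnalysis

/-! ### The converse for a fixed code -/

section Converse

open MeasureTheory

variable {𝓧 𝓨 : Type*} {n M : ℕ} [Fintype 𝓨] [MeasurableSpace 𝓨]

/-- Expectation of a function of the message and the outputs, for a uniform message. -/
noncomputable def expect (P₀ : Measure ({v : ℕ × ℕ // IsInitial v} → 𝓨))
    (Q : 𝓧 → 𝓨 → 𝓨 → 𝓨 → ℝ) (c : FeedbackCode 𝓧 𝓨 n M)
    (f : Fin M → (grid n → 𝓨) → ℝ) : ℝ :=
  (∑ w, ∑ y, outputProb P₀ Q c w y * f w y) / M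

section Linear

variable (P₀ : Measure ({v : ℕ × ℕ // IsInitial v} → 𝓨)) (Q : 𝓧 → 𝓨 → 𝓨 → 𝓨 → ℝ)
  (c : FeedbackCode 𝓧 𝓨 n M)

theorem expect_sum {κ : Type*} (s : Finset κ) (f : κ → Fin M → (grid n → 𝓨) → ℝ) :
    expect P₀ Q c (fun w y => ∑ k ∈ s, f k w y) = ∑ k ∈ s, expect P₀ Q c (f k) := by
  unfold expect
  rw [← Finset.sum_div, Finset.sum_comm (s := s)]
  refine congrArg (· / (M : ℝ)) (Finset.sum_congr rfl fun w _ => ?_)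
  rw [Finset.sum_comm (s := s)]
  exact Finset.sum_congr rfl fun y _ => Finset.mul_sum _ _ _

theorem expect_add (f g : Fin M → (grid n → 𝓨) → ℝ) :
    expect P₀ Q c (fun w y => f w y + g w y) = expect P₀ Q c f + expect P₀ Q c g := by
  unfold expect
  simp only [mul_add, Finset.sum_add_distrib, add_div]

theorem expect_mul_const (f : Fin M → (grid n → 𝓨) → ℝ) (a : ℝ) :
    expect P₀ Q c (fun w y => f w y * a) = expect P₀ Q c f * a := by
  unfold expect
  simp only [← mul_assoc, ← Finset.sum_mul, div_mul_eq_mul_div]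

theorem errorProb_eq_expect [DecidableEq (Fin M)] :
    errorProb P₀ Q c
      = expect P₀ Q c (fun w y => if c.dec (fun v => y (toGrid v)) ≠ w then 1 else 0) := by
  unfold errorProb expect
  refine congrArg (· / (M : ℝ)) (Finset.sum_congr rfl fun w _ => ?_)
  rw [Finset.sum_filter]
  refine Finset.sum_congr rfl fun y _ => ?_
  by_cases h : c.dec (fun v => y (toGrid v)) = w <;> simp [h]

end Linear

variable (P₀ : Measure ({v : ℕ × ℕ // IsInitial v} → 𝓨)) {Q : 𝓧 → 𝓨 → 𝓨 → 𝓨 → ℝ}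
  (hQ : ∀ x y₁ y₂, Q x y₁ y₂ ∈ stdSimplex ℝ 𝓨) (c : FeedbackCode 𝓧 𝓨 n M)

include hQ in
theorem expect_mono {f g : Fin M → (grid n → 𝓨) → ℝ}
    (h : ∀ w y, f w y ≤ g w y) : expect P₀ Q c f ≤ expect P₀ Q c g := by
  unfold expect
  refine div_le_div_of_nonneg_right (Finset.sum_le_sum fun w _ => Finset.sum_le_sum fun y _ =>
    mul_le_mul_of_nonneg_left (h w y) (outputProb_nonneg P₀ hQ c w y)) (Nat.cast_nonneg M)

include hQ in
theorem expect_const [DiscreteMeasurableSpace 𝓨] [Nonempty 𝓨] [IsProbabilityMeasure P₀]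
    (hM : M ≠ 0) (a : ℝ) : expect P₀ Q c (fun _ _ => a) = a := by
  unfold expect
  simp only [← Finset.sum_mul, sum_outputProb P₀ hQ]
  have : (M : ℝ) ≠ 0 := by exact_mod_cast hM
  simp
  field_simp

include hQ in
theorem expect_output [Nonempty 𝓨] (v : commGrid n) (φ : 𝓧 × 𝓨 × 𝓨 → 𝓨 → ℝ) :
    expect P₀ Q c (fun w y => φ (channelInput c v w y) (y (toGrid v)))
      = expect P₀ Q c (fun w y => (fun z : 𝓧 × 𝓨 × 𝓨 => ∑ b, Q z.1 z.2.1 z.2.2 b * φ z b)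
          (channelInput c v w y)) := by
  unfold expect
  exact congrArg (· / (M : ℝ))
    (Finset.sum_congr rfl fun w _ => sum_outputProb_mul_eq P₀ hQ c w v φ)

open Classical in
/-- The law of the channel input and of the two neighboring outputs at a uniformly chosen
communication node. -/
noncomputable def inputLaw (P₀ : Measure ({v : ℕ × ℕ // IsInitial v} → 𝓨))
    (Q : 𝓧 → 𝓨 → 𝓨 → 𝓨 → ℝ) (c : FeedbackCode 𝓧 𝓨 n M) (z : 𝓧 × 𝓨 × 𝓨) : ℝ :=
  (∑ v, expect P₀ Q c (fun w y => if channelInput c v w y = z then 1 else 0))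
    / (commGrid n).card

theorem sum_inputLaw_mul [Fintype 𝓧] (φ : 𝓧 × 𝓨 × 𝓨 → ℝ) :
    ∑ z, inputLaw P₀ Q c z * φ z
      = (∑ v, expect P₀ Q c (fun w y => φ (channelInput c v w y))) / (commGrid n).card := by
  classical
  unfold inputLaw
  simp only [div_mul_eq_mul_div]
  rw [← Finset.sum_div]
  congr 1
  simp only [Finset.sum_mul, ← expect_mul_const]
  rw [Finset.sum_comm]
  refine Finset.sum_congr rfl fun v _ => ?_
  rw [← expect_sum]
  congr 1
  funext w y
  simp

include hQ in
theorem sum_inputLaw_mul_channel [Fintype 𝓧] [Nonempty 𝓨] (φ : 𝓧 × 𝓨 × 𝓨 → 𝓨 → ℝ) :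
    ∑ z, inputLaw P₀ Q c z * ∑ b, Q z.1 z.2.1 z.2.2 b * φ z b
      = (∑ v, expect P₀ Q c (fun w y => φ (channelInput c v w y) (y (toGrid v))))
          / (commGrid n).card := by
  rw [sum_inputLaw_mul P₀ c (fun z => ∑ b, Q z.1 z.2.1 z.2.2 b * φ z b)]
  simp only [expect_output P₀ hQ c]

include hQ in
theorem inputLaw_nonneg (z : 𝓧 × 𝓨 × 𝓨) : 0 ≤ inputLaw P₀ Q c z := by
  classical
  refine div_nonneg (Finset.sum_nonneg fun v _ => ?_) (Nat.cast_nonneg _)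
  refine div_nonneg (Finset.sum_nonneg fun w _ => Finset.sum_nonneg fun y _ =>
    mul_nonneg (outputProb_nonneg P₀ hQ c w y) ?_) (Nat.cast_nonneg _)
  dsimp only
  split_ifs <;> norm_num

-- This absolute continuity keeps `outputLaw` positive along every configuration of positive
-- probability, so that logarithms can be taken there.
include hQ in
theorem inputLaw_pos {w : Fin M} {y : grid n → 𝓨} (h : 0 < outputProb P₀ Q c w y)
    (v : commGrid n) : 0 < inputLaw P₀ Q c (channelInput c v w y) := by
  classical
  have hM : (0 : ℝ) < M := by exact_mod_cast w.pos
  have hN : (0 : ℝ) < (commGrid n).card := by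
    exact_mod_cast Finset.card_pos.2 ⟨v.1, v.2⟩
  have hnn : ∀ (w' : Fin M) (y' : grid n → 𝓨) (v' : commGrid n), 0 ≤ outputProb P₀ Q c w' y' *
      (if channelInput c v' w' y' = channelInput c v w y then 1 else 0) := by
    intro w' y' v'
    refine mul_nonneg (outputProb_nonneg P₀ hQ c w' y') ?_
    split_ifs <;> norm_num
  refine div_pos (Finset.sum_pos' (fun v' _ => ?_) ⟨v, Finset.mem_univ v, ?_⟩) hN
  · exact div_nonneg (Finset.sum_nonneg fun w' _ => Finset.sum_nonneg fun y' _ => hnn w' y' v')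
      hM.le
  · refine div_pos (Finset.sum_pos' (fun w' _ => Finset.sum_nonneg fun y' _ => hnn w' y' v)
      ⟨w, Finset.mem_univ w, ?_⟩) hM
    refine Finset.sum_pos' (fun y' _ => hnn w y' v) ⟨y, Finset.mem_univ y, ?_⟩
    simpa using h

theorem card_commGrid (n : ℕ) : (commGrid n).card = n * n := by
  unfold commGrid
  simp [Finset.card_Icc_prod]

include hQ in
theorem inputLaw_mem_stdSimplex [Fintype 𝓧] [DiscreteMeasurableSpace 𝓨] [Nonempty 𝓨]
    [IsProbabilityMeasure P₀] (hM : M ≠ 0) (hn : n ≠ 0) :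
    inputLaw P₀ Q c ∈ stdSimplex ℝ (𝓧 × 𝓨 × 𝓨) := by
  refine ⟨inputLaw_nonneg P₀ hQ c, ?_⟩
  have h := sum_inputLaw_mul P₀ (Q := Q) c (fun _ => 1)
  simp only [mul_one, expect_const P₀ hQ c hM] at h
  rw [h]
  have : ((commGrid n).card : ℝ) ≠ 0 := by
    rw [card_commGrid]; exact_mod_cast mul_ne_zero hn hn
  simp [this]

theorem sum_commGrid (n : ℕ) (a : ℕ × ℕ → ℝ) :
    ∑ v : commGrid n, a v.1 = ∑ i ∈ Finset.range n, ∑ j ∈ Finset.range n, a (i + 1, j + 1) := by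
  rw [Finset.univ_eq_attach, Finset.sum_attach (commGrid n) a]
  unfold commGrid
  rw [← Finset.Icc_product_Icc, Finset.sum_product]
  have h : ∀ f : ℕ → ℝ, ∑ i ∈ Finset.Icc 1 n, f i = ∑ i ∈ Finset.range n, f (i + 1) := by
    intro f
    rw [Finset.range_eq_Ico, Finset.sum_Ico_add' f 0 n 1]
    rfl
  simp only [h]

/-- Telescoping along the rows. -/
theorem abs_sum_sub_left_le (n : ℕ) (a : ℕ × ℕ → ℝ) (h0 : ∀ u, 0 ≤ a u) (h1 : ∀ u, a u ≤ 1) :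
    |∑ v : commGrid n, (a v.1 - a (v.1.1 - 1, v.1.2))| ≤ n := by
  rw [sum_commGrid n (fun v => a v - a (v.1 - 1, v.2)), Finset.sum_comm]
  simp only [Nat.add_sub_cancel]
  calc _ ≤ ∑ j ∈ Finset.range n, |∑ i ∈ Finset.range n, (a (i + 1, j + 1) - a (i, j + 1))| :=
        Finset.abs_sum_le_sum_abs _ _
    _ ≤ ∑ j ∈ Finset.range n, (1 : ℝ) := by
        refine Finset.sum_le_sum fun j _ => ?_
        rw [Finset.sum_range_sub (fun i => a (i, j + 1)), abs_le]
        constructor <;> linarith [h0 (n, j + 1), h1 (n, j + 1), h0 (0, j + 1), h1 (0, j + 1)]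
    _ = n := by simp

/-- Telescoping along the columns. -/
theorem abs_sum_sub_bottom_le (n : ℕ) (a : ℕ × ℕ → ℝ) (h0 : ∀ u, 0 ≤ a u) (h1 : ∀ u, a u ≤ 1) :
    |∑ v : commGrid n, (a v.1 - a (v.1.1, v.1.2 - 1))| ≤ n := by
  rw [sum_commGrid n (fun v => a v - a (v.1, v.2 - 1))]
  simp only [Nat.add_sub_cancel]
  calc _ ≤ ∑ i ∈ Finset.range n, |∑ j ∈ Finset.range n, (a (i + 1, j + 1) - a (i + 1, j))| :=
        Finset.abs_sum_le_sum_abs _ _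
    _ ≤ ∑ j ∈ Finset.range n, (1 : ℝ) := by
        refine Finset.sum_le_sum fun i _ => ?_
        rw [Finset.sum_range_sub (fun j => a (i + 1, j)), abs_le]
        constructor <;> linarith [h0 (i + 1, n), h1 (i + 1, n), h0 (i + 1, 0), h1 (i + 1, 0)]
    _ = n := by simp

-- For each symbol and each direction, the differences telescope on each of the `n` lines to at most
-- one in absolute value; dividing by `n * n` nodes leaves `1 / n`. The constant counts two
-- directions and all symbols.
include hQ in
theorem mismatch_inputLaw_le [Fintype 𝓧] [DiscreteMeasurableSpace 𝓨] [Nonempty 𝓨]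
    [IsProbabilityMeasure P₀] (hM : M ≠ 0) (hn : n ≠ 0) :
    mismatch Q (inputLaw P₀ Q c) ≤ Fintype.card 𝓨 * 2 / n := by
  classical
  have hn' : (0 : ℝ) < n := by exact_mod_cast Nat.pos_of_ne_zero hn
  have hb : ∀ b : 𝓨, |∑ x, ∑ y₁, ∑ y₂, inputLaw P₀ Q c (x, y₁, y₂) * Q x y₁ y₂ b
        - ∑ x, ∑ y₂, inputLaw P₀ Q c (x, b, y₂)|
      + |∑ x, ∑ y₁, ∑ y₂, inputLaw P₀ Q c (x, y₁, y₂) * Q x y₁ y₂ b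
        - ∑ x, ∑ y₁, inputLaw P₀ Q c (x, y₁, b)| ≤ 2 / n := by
    intro b
    -- The probability that the output at `u` is `b`, extended by zero off the square so that the
    -- telescoping lemmas on `ℕ × ℕ` apply.
    set a : ℕ × ℕ → ℝ := fun u => if hu : u ∈ grid n then
      expect P₀ Q c (fun _ y => if y ⟨u, hu⟩ = b then 1 else 0) else 0 with ha
    have ha_grid : ∀ u : grid n,
        expect P₀ Q c (fun _ y => if y u = b then 1 else 0) = a u.1 := by
      intro u
      simp only [ha]
      rw [dif_pos u.2]
    have ha0 : ∀ u, 0 ≤ a u := by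
      intro u
      simp only [ha]
      split_ifs with hu
      · refine (expect_const P₀ hQ c hM 0).symm.trans_le ?_
        refine expect_mono P₀ hQ c fun w y => ?_
        split_ifs <;> norm_num
      · exact le_rfl
    have ha1 : ∀ u, a u ≤ 1 := by
      intro u
      simp only [ha]
      split_ifs with hu
      · refine le_trans ?_ (expect_const P₀ hQ c hM 1).le
        refine expect_mono P₀ hQ c fun w y => ?_
        split_ifs <;> norm_num
      · exact zero_le_one
    have hY : ∑ x, ∑ y₁, ∑ y₂, inputLaw P₀ Q c (x, y₁, y₂) * Q x y₁ y₂ b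
        = (∑ v : commGrid n, a v.1) / (commGrid n).card := by
      have h := sum_inputLaw_mul_channel P₀ hQ c (fun _ b' => if b' = b then 1 else 0)
      simp only [mul_ite, mul_one, mul_zero, Finset.sum_ite_eq', Finset.mem_univ, if_true,
        Fintype.sum_prod_type] at h
      rw [h]
      congr 1
      exact Finset.sum_congr rfl fun v _ => ha_grid (toGrid v)
    have h1 : ∑ x, ∑ y₂, inputLaw P₀ Q c (x, b, y₂)
        = (∑ v : commGrid n, a (v.1.1 - 1, v.1.2)) / (commGrid n).card := by
      have h := sum_inputLaw_mul P₀ (Q := Q) c (fun z => if z.2.1 = b then 1 else 0)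
      simp only [mul_ite, mul_one, mul_zero, Fintype.sum_prod_type] at h
      have h' : ∀ x, ∑ y₁, ∑ y₂, (if y₁ = b then inputLaw P₀ Q c (x, y₁, y₂) else 0)
          = ∑ y₂, inputLaw P₀ Q c (x, b, y₂) := by
        intro x
        rw [Finset.sum_comm]
        simp
      simp only [h'] at h
      rw [h]
      congr 1
      exact Finset.sum_congr rfl fun v _ => ha_grid (left v)
    have h2 : ∑ x, ∑ y₁, inputLaw P₀ Q c (x, y₁, b)
        = (∑ v : commGrid n, a (v.1.1, v.1.2 - 1)) / (commGrid n).card := by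
      have h := sum_inputLaw_mul P₀ (Q := Q) c (fun z => if z.2.2 = b then 1 else 0)
      simp only [mul_ite, mul_one, mul_zero, Fintype.sum_prod_type, Finset.sum_ite_eq',
        Finset.mem_univ, if_true] at h
      rw [h]
      congr 1
      exact Finset.sum_congr rfl fun v _ => ha_grid (bottom v)
    rw [hY, h1, h2, ← sub_div, ← sub_div, ← Finset.sum_sub_distrib, ← Finset.sum_sub_distrib,
      abs_div, abs_div, ← add_div, card_commGrid, Nat.cast_mul, abs_mul_self]
    have e1 := abs_sum_sub_left_le n a ha0 ha1
    have e2 := abs_sum_sub_bottom_le n a ha0 ha1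
    rw [div_le_div_iff₀ (by positivity) hn']
    nlinarith
  calc mismatch Q (inputLaw P₀ Q c) ≤ ∑ _b : 𝓨, (2 / n : ℝ) := Finset.sum_le_sum fun b _ => hb b
    _ = _ := by rw [Finset.sum_const, Finset.card_univ, nsmul_eq_mul, mul_div_assoc]

/-- The conditional law of the output given the two neighbors, completed by `Q` at a fixed
input where the neighbors have probability zero. -/
noncomputable def outputLaw [Fintype 𝓧] [Nonempty 𝓧] (Q : 𝓧 → 𝓨 → 𝓨 → 𝓨 → ℝ)
    (P : 𝓧 × 𝓨 × 𝓨 → ℝ) (y₁ y₂ b : 𝓨) : ℝ :=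
  open Classical in
  if ∑ x, P (x, y₁, y₂) = 0 then Q (Classical.arbitrary 𝓧) y₁ y₂ b
  else (∑ x, P (x, y₁, y₂) * Q x y₁ y₂ b) / ∑ x, P (x, y₁, y₂)

omit [MeasurableSpace 𝓨] in
include hQ in
theorem outputLaw_mem_stdSimplex [Fintype 𝓧] [Nonempty 𝓧] {P : 𝓧 × 𝓨 × 𝓨 → ℝ}
    (hP : ∀ z, 0 ≤ P z) (y₁ y₂ : 𝓨) : outputLaw Q P y₁ y₂ ∈ stdSimplex ℝ 𝓨 := by
  unfold outputLaw
  by_cases h : ∑ x, P (x, y₁, y₂) = 0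
  · simp only [h, if_true]
    exact hQ _ _ _
  · simp only [h, if_false]
    refine ⟨fun b => div_nonneg (Finset.sum_nonneg fun x _ =>
      mul_nonneg (hP _) ((hQ _ _ _).1 b)) (Finset.sum_nonneg fun x _ => hP _), ?_⟩
    rw [← Finset.sum_div, Finset.sum_comm]
    simp only [← Finset.mul_sum, (hQ _ _ _).2, mul_one]
    exact div_self h

omit [Fintype 𝓨] [MeasurableSpace 𝓨] in
theorem outputLaw_eq [Fintype 𝓧] [Nonempty 𝓧] {P : 𝓧 × 𝓨 × 𝓨 → ℝ} (hP : ∀ z, 0 ≤ P z)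
    {x : 𝓧} {y₁ y₂ : 𝓨} (h : 0 < P (x, y₁, y₂)) (b : 𝓨) :
    outputLaw Q P y₁ y₂ b
      = (∑ x, P (x, y₁, y₂) * Q x y₁ y₂ b) / ∑ x, P (x, y₁, y₂) := by
  unfold outputLaw
  rw [if_neg]
  exact (h.trans_le (Finset.single_le_sum (f := fun x => P (x, y₁, y₂)) (fun x _ => hP _)
    (Finset.mem_univ x))).ne'

omit [MeasurableSpace 𝓨] in
include hQ in
theorem outputLaw_pos [Fintype 𝓧] [Nonempty 𝓧] {P : 𝓧 × 𝓨 × 𝓨 → ℝ} (hP : ∀ z, 0 ≤ P z)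
    {x : 𝓧} {y₁ y₂ b : 𝓨} (h : 0 < P (x, y₁, y₂)) (hb : 0 < Q x y₁ y₂ b) :
    0 < outputLaw Q P y₁ y₂ b := by
  rw [outputLaw_eq hP h]
  refine div_pos ((mul_pos h hb).trans_le ?_) (h.trans_le ?_)
  · exact Finset.single_le_sum (f := fun x => P (x, y₁, y₂) * Q x y₁ y₂ b)
      (fun x _ => mul_nonneg (hP _) ((hQ _ _ _).1 b)) (Finset.mem_univ x)
  · exact Finset.single_le_sum (f := fun x => P (x, y₁, y₂)) (fun x _ => hP _)
      (Finset.mem_univ x)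

/-- The information density of a single channel use. -/
noncomputable def infoDensity [Fintype 𝓧] [Nonempty 𝓧] (Q : 𝓧 → 𝓨 → 𝓨 → 𝓨 → ℝ)
    (P : 𝓧 × 𝓨 × 𝓨 → ℝ) (z : 𝓧 × 𝓨 × 𝓨) (b : 𝓨) : ℝ :=
  Real.log (Q z.1 z.2.1 z.2.2 b) - Real.log (outputLaw Q P z.2.1 z.2.2 b)

omit [MeasurableSpace 𝓨] in
include hQ in
theorem condMutualInfo_jointLaw [Fintype 𝓧] [Nonempty 𝓧] {P : 𝓧 × 𝓨 × 𝓨 → ℝ}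
    (hP : ∀ z, 0 ≤ P z) :
    condMutualInfo (jointLaw Q P)
      = ∑ z, P z * ∑ b, Q z.1 z.2.1 z.2.2 b * infoDensity Q P z b := by
  have h := condMutualInfo_channel (P := P) (W := fun x (c : 𝓨 × 𝓨) => Q x c.1 c.2) hP
    (fun x c => hQ x c.1 c.2)
  refine h.trans ?_
  rw [Fintype.sum_prod_type]
  refine Finset.sum_congr rfl fun x _ => Finset.sum_congr rfl fun d _ => ?_
  rw [Finset.mul_sum]
  refine Finset.sum_congr rfl fun b _ => ?_
  -- Triples of probability zero contribute nothing, so the arbitrary completion in `outputLaw` is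
  -- invisible.
  rcases (hP (x, d)).eq_or_lt with h0 | hpos
  · simp [← h0]
  · simp only [infoDensity]
    rw [outputLaw_eq hP hpos, mul_assoc]

include hQ in
/-- The mean of the total information density is `|C_n|` times the mutual information. -/
theorem expect_sum_infoDensity [Fintype 𝓧] [Nonempty 𝓧] [Nonempty 𝓨] (hn : n ≠ 0) :
    expect P₀ Q c (fun w y => ∑ v, infoDensity Q (inputLaw P₀ Q c) (channelInput c v w y)
        (y (toGrid v)))
      = (commGrid n).card * condMutualInfo (jointLaw Q (inputLaw P₀ Q c)) := by
  have : ((commGrid n).card : ℝ) ≠ 0 := by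
    rw [card_commGrid]; exact_mod_cast mul_ne_zero hn hn
  rw [condMutualInfo_jointLaw hQ (inputLaw_nonneg P₀ hQ c), sum_inputLaw_mul_channel P₀ hQ c,
    expect_sum, mul_div_cancel₀ _ this]

-- Both configuration laws share the initial factor, which cancels in the ratio; what remains is a
-- product over nodes, whose logarithm is the sum of the densities.
include hQ in
theorem infoDensity_sum_eq [Fintype 𝓧] [Nonempty 𝓧] {w : Fin M} {y : grid n → 𝓨}
    (h : 0 < outputProb P₀ Q c w y) :
    0 < outputProb P₀ (fun _ : 𝓧 => outputLaw Q (inputLaw P₀ Q c)) c w y ∧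
    ∑ v, infoDensity Q (inputLaw P₀ Q c) (channelInput c v w y) (y (toGrid v))
      = Real.log (outputProb P₀ Q c w y)
        - Real.log (outputProb P₀ (fun _ : 𝓧 => outputLaw Q (inputLaw P₀ Q c)) c w y) := by
  rw [outputProb_eq] at h
  have h0 : 0 < initialProb P₀ y := lt_of_le_of_ne measureReal_nonneg (fun h' => by
    rw [← h', zero_mul] at h; exact lt_irrefl _ h)
  have hq : ∀ v, 0 < nodeProb Q c w v y := fun v =>
    lt_of_le_of_ne ((hQ _ _ _).1 _) (fun h' => by
      rw [Finset.prod_eq_zero (Finset.mem_univ v) h'.symm, mul_zero] at h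
      exact lt_irrefl _ h)
  have hr : ∀ v, 0 < nodeProb (fun _ : 𝓧 => outputLaw Q (inputLaw P₀ Q c)) c w v y := fun v =>
    outputLaw_pos hQ (inputLaw_nonneg P₀ hQ c) (inputLaw_pos P₀ hQ c h v) (hq v)
  refine ⟨mul_pos h0 (Finset.prod_pos fun v _ => hr v), ?_⟩
  rw [outputProb_eq, outputProb_eq, Real.log_mul h0.ne' (Finset.prod_pos fun v _ => hq v).ne',
    Real.log_mul h0.ne' (Finset.prod_pos fun v _ => hr v).ne',
    Real.log_prod fun v _ => (hq v).ne', Real.log_prod fun v _ => (hr v).ne',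
    add_sub_add_left_eq_sub, ← Finset.sum_sub_distrib]
  rfl

/-- The pointwise inequality behind the converse. -/
theorem gibbs_pointwise {p r m s : ℝ} (hp : 0 < p) (hr : 0 < r) (hm : 1 ≤ m)
    (hs : s = 0 ∨ s = 1) :
    p - r / 2 * (m * (1 - s) + 1)
      ≤ p * ((Real.log p - Real.log r) - Real.log m + Real.log 2 + s * Real.log m) := by
  have hm0 : 0 < m := by linarith
  -- This is `log t ≤ t - 1` at `t = g / p`. It is used with `g = r / 2 * m` when decoding succeeds
  -- and `g = r / 2` when it fails.
  have key : ∀ g : ℝ, 0 < g → p - g ≤ p * (Real.log p - Real.log g) := by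
    intro g hg
    have h1 := Real.log_le_sub_one_of_pos (div_pos hg hp)
    rw [Real.log_div hg.ne' hp.ne'] at h1
    have h2 := mul_le_mul_of_nonneg_left h1 hp.le
    have h3 : p * (g / p - 1) = g - p := by field_simp
    rw [h3] at h2
    linarith
  rcases hs with rfl | rfl
  · have h := key (r / 2 * m) (by positivity)
    rw [Real.log_mul (by positivity) hm0.ne', Real.log_div hr.ne' two_ne_zero] at h
    nlinarith
  · have h := key (r / 2) (by positivity)
    rw [Real.log_div hr.ne' two_ne_zero] at h
    nlinarith

include hQ in
/-- The converse bound for a fixed code, in terms of a single-letter mutual information. -/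
theorem log_card_le_card_mul_condMutualInfo [Fintype 𝓧] [Nonempty 𝓧]
    [DiscreteMeasurableSpace 𝓨] [Nonempty 𝓨] [IsProbabilityMeasure P₀]
    (hM : M ≠ 0) (hn : n ≠ 0) :
    (1 - errorProb P₀ Q c) * Real.log M - Real.log 2
      ≤ (commGrid n).card * condMutualInfo (jointLaw Q (inputLaw P₀ Q c)) := by
  classical
  have hM0 : (0 : ℝ) < M := by exact_mod_cast Nat.pos_of_ne_zero hM
  have hM1 : (1 : ℝ) ≤ M := by exact_mod_cast Nat.one_le_iff_ne_zero.2 hM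
  -- `R` ignores the channel input, so the output law it induces is the same for every message.
  set R : (𝓧 → 𝓨 → 𝓨 → 𝓨 → ℝ) := fun _ => outputLaw Q (inputLaw P₀ Q c) with hRdef
  have hR : ∀ x y₁ y₂, R x y₁ y₂ ∈ stdSimplex ℝ 𝓨 := fun _ y₁ y₂ =>
    outputLaw_mem_stdSimplex hQ (inputLaw_nonneg P₀ hQ c) y₁ y₂
  set w₀ : Fin M := ⟨0, Nat.pos_of_ne_zero hM⟩
  set r : (grid n → 𝓨) → ℝ := outputProb P₀ R c w₀ with hr
  have hrw : ∀ w, outputProb P₀ R c w = r := fun w => rfl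
  set s : Fin M → (grid n → 𝓨) → ℝ :=
    fun w y => if c.dec (fun v => y (toGrid v)) ≠ w then 1 else 0 with hs
  set D : Fin M → (grid n → 𝓨) → ℝ := fun w y =>
    ∑ v, infoDensity Q (inputLaw P₀ Q c) (channelInput c v w y) (y (toGrid v)) with hD
  have hs01 : ∀ w y, s w y = 0 ∨ s w y = 1 := by
    intro w y
    simp only [hs]
    split_ifs <;> simp
  -- Exactly one message is the decoded one. The reference is thus an even mixture of two joint
  -- laws: outputs from `r` with the message equal to the decoded one, or uniform and independent.
  -- The factor `1 / 2` produces the `log 2`.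
  have hsM : ∀ y, ∑ w, (M * (1 - s w y) + 1) = 2 * (M : ℝ) := by
    intro y
    have : ∑ w, (1 - s w y) = 1 := by
      have : ∀ w, 1 - s w y = if c.dec (fun v => y (toGrid v)) = w then 1 else 0 := by
        intro w
        by_cases h : c.dec (fun v => y (toGrid v)) = w <;> simp [hs, h]
      simp [this]
    rw [Finset.sum_add_distrib, ← Finset.mul_sum, this]
    simp
    ring
  have hpt : ∀ w y, outputProb P₀ Q c w y - r y / 2 * (M * (1 - s w y) + 1)
      ≤ outputProb P₀ Q c w y
        * (D w y + (-Real.log M + Real.log 2) + s w y * Real.log M) := by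
    intro w y
    rcases (outputProb_nonneg P₀ hQ c w y).eq_or_lt with h0 | hpos
    · rw [← h0, zero_mul, zero_sub, neg_nonpos]
      refine mul_nonneg (div_nonneg (outputProb_nonneg P₀ hR c _ y) zero_le_two) ?_
      have : 0 ≤ 1 - s w y := by rcases hs01 w y with h | h <;> simp [h]
      positivity
    · obtain ⟨hrpos, heq⟩ := infoDensity_sum_eq P₀ hQ c hpos
      have := gibbs_pointwise hpos hrpos hM1 (hs01 w y)
      refine this.trans (le_of_eq ?_)
      rw [← heq]
      simp only [hD]
      ring
  have hsum : (0 : ℝ) ≤ expect P₀ Q c (fun w y =>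
      D w y + (-Real.log M + Real.log 2) + s w y * Real.log M) := by
    refine div_nonneg ?_ hM0.le
    -- Summed over messages and outputs, both terms on the left of `hpt` have total mass `M`, so
    -- their difference is zero.
    refine le_trans (le_of_eq ?_) (Finset.sum_le_sum fun w _ => Finset.sum_le_sum fun y _ => hpt w y)
    simp only [Finset.sum_sub_distrib, sum_outputProb P₀ hQ]
    rw [Finset.sum_comm (s := (Finset.univ : Finset (Fin M)))]
    simp only [← Finset.mul_sum, hsM]
    rw [← Finset.sum_mul, ← Finset.sum_div, hr, sum_outputProb P₀ hR]
    simp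
  rw [expect_add, expect_add, expect_const P₀ hQ c hM, expect_mul_const,
    ← errorProb_eq_expect, hD, expect_sum_infoDensity P₀ hQ c hn] at hsum
  linarith

end Converse

/-! ### Passing to the capacity -/

section Capacity

open MeasureTheory

variable {𝓧 𝓨 : Type*} [Fintype 𝓨] [MeasurableSpace 𝓨]
  (P₀ : Measure ({v : ℕ × ℕ // IsInitial v} → 𝓨))

theorem maxMessages_mono (Q : 𝓧 → 𝓨 → 𝓨 → 𝓨 → ℝ) (n : ℕ) : Monotone (maxMessages P₀ Q n) :=
  fun _ _ h => biSup_mono fun _ ⟨c, hc⟩ => ⟨c, hc.trans h⟩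

theorem achievableRate_mono (Q : 𝓧 → 𝓨 → 𝓨 → 𝓨 → ℝ) : Monotone (achievableRate P₀ Q) := by
  intro ε ε' h
  refine liminf_le_liminf (Eventually.of_forall fun n => ?_)
  refine EReal.div_le_div_right_of_nonneg (by exact_mod_cast Nat.zero_le _) ?_
  exact ENNReal.log_le_log (ENat.toENNReal_mono (maxMessages_mono P₀ Q n h))

/-- A monotone function into the complete linear order `EReal` has a right limit at every point, so
`limUnder` is a genuine limit here. -/
theorem tendsto_achievableRate (Q : 𝓧 → 𝓨 → 𝓨 → 𝓨 → ℝ) :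
    Tendsto (achievableRate P₀ Q) (𝓝[>] (0 : ℝ)) (𝓝 (feedbackCapacity P₀ Q)) :=
  tendsto_nhds_limUnder ⟨_, (achievableRate_mono P₀ Q).tendsto_nhdsGT 0⟩

theorem log_maxMessages_le {Q : 𝓧 → 𝓨 → 𝓨 → 𝓨 → ℝ} {n : ℕ} {ε B : ℝ}
    (h : ∀ (M : ℕ) (c : FeedbackCode 𝓧 𝓨 n M), M ≠ 0 → errorProb P₀ Q c ≤ ε →
      Real.log M ≤ B) :
    ENNReal.log (maxMessages P₀ Q n ε : ENNReal) ≤ B := by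
  have h1 : maxMessages P₀ Q n ε ≤ (⌊Real.exp B⌋₊ : ℕ∞) := by
    refine iSup₂_le fun M ⟨c, hc⟩ => ?_
    refine Nat.cast_le.2 (Nat.le_floor ?_)
    rcases eq_or_ne M 0 with rfl | hM
    · simpa using (Real.exp_pos B).le
    · have hM0 : (0 : ℝ) < M := by exact_mod_cast Nat.pos_of_ne_zero hM
      rw [← Real.log_le_iff_le_exp hM0]
      exact h M c hM hc
  have h2 : (maxMessages P₀ Q n ε : ENNReal) ≤ ENNReal.ofReal (Real.exp B) := by
    refine (ENat.toENNReal_mono h1).trans ?_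
    rw [ENat.toENNReal_coe, ← ENNReal.ofReal_natCast]
    exact ENNReal.ofReal_le_ofReal (Nat.floor_le (Real.exp_pos B).le)
  refine (ENNReal.log_le_log h2).trans ?_
  rw [ENNReal.log_ofReal_of_pos (Real.exp_pos B), Real.log_exp]

variable [Fintype 𝓧] [Nonempty 𝓧] [Nonempty 𝓨] [DiscreteMeasurableSpace 𝓨]
  [IsProbabilityMeasure P₀] {Q : 𝓧 → 𝓨 → 𝓨 → 𝓨 → ℝ}
  (hQ : ∀ x y₁ y₂, Q x y₁ y₂ ∈ stdSimplex ℝ 𝓨)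

-- One `δ` pays for the violated constraints, the other for `log 2 / |C_n|`; both are available once
-- `n` is large.
include hQ in
theorem achievableRate_le {C : ℝ}
    (hC : C ∈ upperBounds ((fun P => condMutualInfo (jointLaw Q P)) '' feasible Q))
    {ε δ : ℝ} (hε : ε < 1) (hδ : 0 < δ) :
    achievableRate P₀ Q ε ≤ ((C + δ + δ) / (1 - ε) : ℝ) := by
  have hε' : 0 < 1 - ε := by linarith
  obtain ⟨η, hη, hbound⟩ := exists_mismatch_bound Q hC hδ
  have hlim1 : Tendsto (fun n : ℕ => (Fintype.card 𝓨 * 2 / n : ℝ)) atTop (𝓝 0) :=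
    tendsto_const_div_atTop_nhds_zero_nat _
  have hlim2 : Tendsto (fun n : ℕ => (Real.log 2 / n : ℝ)) atTop (𝓝 0) :=
    tendsto_const_div_atTop_nhds_zero_nat _
  refine liminf_le_of_frequently_le' (Eventually.frequently ?_)
  filter_upwards [hlim1.eventually_lt_const hη, hlim2.eventually_lt_const hδ,
    eventually_ne_atTop 0] with n h1 h2 hn
  have hn1 : (1 : ℝ) ≤ n := by exact_mod_cast Nat.one_le_iff_ne_zero.2 hn
  have hN : ((commGrid n).card : ℝ) = n * n := by rw [card_commGrid, Nat.cast_mul]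
  have hN0 : (0 : ℝ) < (commGrid n).card := by rw [hN]; positivity
  rw [EReal.div_le_iff_le_mul (by exact_mod_cast hN0) (EReal.coe_ne_top _), ← EReal.coe_mul]
  refine log_maxMessages_le P₀ fun M c hM hc => ?_
  have h3 := log_card_le_card_mul_condMutualInfo P₀ hQ c hM hn
  have h4 := hbound _ (inputLaw_mem_stdSimplex P₀ hQ c hM hn)
    ((mismatch_inputLaw_le P₀ hQ c hM hn).trans_lt h1)
  have h5 : 0 ≤ Real.log M := Real.log_natCast_nonneg M
  rw [div_lt_iff₀ (by linarith)] at h2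
  have h6 := mul_le_mul_of_nonneg_left h4 hN0.le
  have h7 : δ * n ≤ (commGrid n).card * δ := by rw [hN]; nlinarith [mul_pos hδ (by linarith : (0:ℝ) < n)]
  have h8 : (1 - ε) * Real.log M ≤ (1 - errorProb P₀ Q c) * Real.log M :=
    mul_le_mul_of_nonneg_right (by linarith) h5
  rw [mul_div_assoc', le_div_iff₀ hε']
  linarith

include hQ in
theorem feedbackCapacity_le {C : ℝ}
    (hC : C ∈ upperBounds ((fun P => condMutualInfo (jointLaw Q P)) '' feasible Q)) :
    feedbackCapacity P₀ Q ≤ C := by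
  -- The slack `δ` is taken equal to `ε`, so a single limit removes both.
  have hlim : Tendsto (fun ε : ℝ => (((C + ε + ε) / (1 - ε) : ℝ) : EReal)) (𝓝[>] 0)
      (𝓝 (C : EReal)) := by
    refine (continuous_coe_real_ereal.tendsto C).comp ?_
    have : ContinuousAt (fun ε : ℝ => (C + ε + ε) / (1 - ε)) 0 := by
      refine ContinuousAt.div (by fun_prop) (by fun_prop) (by norm_num)
    simpa [ContinuousAt] using this.tendsto.mono_left nhdsWithin_le_nhds
  refine le_of_tendsto_of_tendsto (tendsto_achievableRate P₀ Q) hlim ?_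
  filter_upwards [Ioo_mem_nhdsGT (zero_lt_one' ℝ)] with ε hε
  exact achievableRate_le P₀ hQ hC hε.2 hε.1

-- Any code yields an almost feasible law on a large square; a one-message code with constant input
-- suffices.
include P₀ hQ in
theorem exists_mismatch_le (η : ℝ) (hη : 0 < η) :
    ∃ P ∈ stdSimplex ℝ (𝓧 × 𝓨 × 𝓨), mismatch Q P ≤ η := by
  have hlim : Tendsto (fun n : ℕ => (Fintype.card 𝓨 * 2 / n : ℝ)) atTop (𝓝 0) :=
    tendsto_const_div_atTop_nhds_zero_nat _
  obtain ⟨n, h1, hn⟩ := ((hlim.eventually_lt_const hη).and (eventually_ne_atTop 0)).exists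
  let c : FeedbackCode 𝓧 𝓨 n 1 := ⟨fun _ _ _ => Classical.arbitrary 𝓧, fun _ => 0⟩
  exact ⟨inputLaw P₀ Q c, inputLaw_mem_stdSimplex P₀ hQ c one_ne_zero hn,
    (mismatch_inputLaw_le P₀ hQ c one_ne_zero hn).trans h1.le⟩

end Capacity

end TwoDimNOST

theorem mainTheorem9 {𝓧 𝓨 : Type*} [Fintype 𝓧] [Nonempty 𝓧] [Fintype 𝓨]
    [MeasurableSpace 𝓨] [DiscreteMeasurableSpace 𝓨]
    (P₀ : MeasureTheory.Measure ({v : ℕ × ℕ // TwoDimNOST.IsInitial v} → 𝓨))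
    [MeasureTheory.IsProbabilityMeasure P₀]
    (Q : 𝓧 → 𝓨 → 𝓨 → 𝓨 → ℝ)
    (hQ : ∀ x y₁ y₂, Q x y₁ y₂ ∈ stdSimplex ℝ 𝓨) :
    Tendsto (TwoDimNOST.achievableRate P₀ Q) (𝓝[>] (0 : ℝ))
        (𝓝 (TwoDimNOST.feedbackCapacity P₀ Q)) ∧
      ∃ C : ℝ,
        IsGreatest
          ((fun P => condMutualInfo (TwoDimNOST.jointLaw Q P)) '' TwoDimNOST.feasible Q) C ∧
        TwoDimNOST.feedbackCapacity P₀ Q ≤ (C : EReal) := by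
  -- A probability measure lives on a nonempty space, and a boundary configuration has a value at
  -- the initial node `(0, 0)`.
  have : Nonempty 𝓨 := by
    obtain ⟨ω⟩ := P₀.nonempty_of_neZero
    exact ⟨ω ⟨(0, 0), Or.inl rfl⟩⟩
  obtain ⟨C, hC⟩ := TwoDimNOST.exists_isGreatest Q (TwoDimNOST.exists_mismatch_le P₀ hQ)
  exact ⟨TwoDimNOST.tendsto_achievableRate P₀ Q, C, hC,
    TwoDimNOST.feedbackCapacity_le P₀ hQ hC.2⟩
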